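/- Let $n \ge 2$ and $N = n^2$, and consider the $\sqrt N \times \sqrt N$ grid with periodic boundary conditions, with vertices $(x,y) \in (\mathbb Z/n\mathbb Z)^2$. The quantum walk acts on $\mathcal H = \mathbb C^4 \otimes \mathbb C^N$ with orthonormal basis $|i\rangle\otimes|x,y\rangle$, where $i \in \{\rightarrow,\leftarrow,\uparrow,\downarrow\}$ is the coin register. Let $|s\rangle = \frac12\sum_i |i\rangle$, let $C_0 = 2|s\rangle\langle s| - I$ be the Grover coin, and let $S_{ff}$ be the flip-flop shift $$|\rightarrow\rangle|x,y\rangle \mapsto |\leftarrow\rangle|x+1,y\rangle,\quad |\leftarrow\rangle|x,y\rangle \mapsto |\rightarrow\rangle|x-1,y\rangle,\quad |\uparrow\rangle|x,y\rangle \mapsto |\downarrow\rangle|x,y+1\rangle,\quad |\downarrow\rangle|x,y\rangle \mapsto |\uparrow\rangle|x,y-1\rangle .$$ For a marked vertex $v$ put $$U'_v = S_{ff}\,\bigl(C_0\otimes(I-|v\rangle\langle v|) + (-I)\otimes|v\rangle\langle v|\bigr),\qquad |\Phi_0\rangle = \frac{1}{\sqrt{4N}}\sum_{i}\sum_{x,y}|i\rangle\otimes|x,y\rangle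 .$$ Then there is a number of steps $T = T(N) = O(\sqrt{N\log N})$, not depending on $v$, such that for every marked vertex $v$ the probability $$p_T = \sum_i \bigl|\bigl(\langle i|\otimes\langle v|\bigr)\,(U'_v)^T|\Phi_0\rangle\bigr|^2$$ of finding $v$ when the position register is measured after $T$ steps satisfies $p_T = \Omega(1/\log N)$. That is, there are absolute constants $K, c > 0$ such that for all $n \ge 2$ one can choose $T \le K\sqrt{N\log N}$ with $p_T \ge c/\log N$ for all $v$. -/

import Mathlib

open scoped Matrix Kronecker

noncomputable section

namespace GridWalk

/-- The four edge labels `→, ←, ↑, ↓` at a vertex of the grid: the basis of the coin space. -/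
inductive Dir
  | right
  | left
  | up
  | down
  deriving DecidableEq

instance : Fintype Dir where
  elems := {.right, .left, .up, .down}
  complete := by intro i; cases i <;> simp

/-- The vertices of the `n × n` grid with periodic boundary conditions (so `N = n ^ 2`). -/
abbrev Vertex (n : ℕ) : Type := ZMod n × ZMod n

/-- The computational basis `|i⟩ ⊗ |x, y⟩` of the space of coin and vertices. -/
abbrev Basis (n : ℕ) : Type := Dir × Vertex n

/-- The coin permutation `π` of the flip-flop shift: exchange `→` with `←` and `↑` with `↓`. -/
def Dir.flip : Dir → Dir
  | .right => .left
  | .left => .right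
  | .up => .down
  | .down => .up

/-- The displacement along the edge with a given label. -/
def Dir.step (n : ℕ) : Dir → Vertex n
  | .right => (1, 0)
  | .left => (-1, 0)
  | .up => (0, 1)
  | .down => (0, -1)

/-- The uniform coin state `|s⟩ = (1 / √4) ∑ i, |i⟩`. -/
def coinState : Dir → ℂ := fun _ => 1 / ((√4 : ℝ) : ℂ)

/-- The Grover coin `C₀ = 2 |s⟩⟨s| - I`. -/
def groverCoin : Matrix Dir Dir ℂ :=
  (2 : ℂ) • Matrix.vecMulVec coinState (star coinState) - 1

/-- The marking coin `C₁ = -I`. -/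
def markingCoin : Matrix Dir Dir ℂ := -1

/-- The flip-flop shift `S_ff : |i⟩ ⊗ |x⟩ ↦ |π i⟩ ⊗ |x + step i⟩`. -/
def flipFlopShift (n : ℕ) : Matrix (Basis n) (Basis n) ℂ :=
  Matrix.of fun b a => if b = (a.1.flip, a.2 + a.1.step n) then 1 else 0

/-- The projection `|v⟩⟨v|` on the vertex space. -/
def vertexProj (n : ℕ) (v : Vertex n) : Matrix (Vertex n) (Vertex n) ℂ :=
  Matrix.single v v 1

/-- The perturbed coin `C' = C₀ ⊗ (I - |v⟩⟨v|) + C₁ ⊗ |v⟩⟨v|`. -/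
def markedCoin (n : ℕ) (v : Vertex n) : Matrix (Basis n) (Basis n) ℂ :=
  groverCoin ⊗ₖ (1 - vertexProj n v) + markingCoin ⊗ₖ vertexProj n v

/-- One step `U' = S_ff C'` of the walk with marked vertex `v`. -/
def markedWalk (n : ℕ) [NeZero n] (v : Vertex n) : Matrix (Basis n) (Basis n) ℂ :=
  flipFlopShift n * markedCoin n v

/-- The uniform superposition `|Φ₀⟩ = (1 / √(4 N)) ∑ i x, |i⟩ ⊗ |x⟩`, with `N = n ^ 2`. -/
def uniformState (n : ℕ) : Basis n → ℂ := fun _ => 1 / ((√(4 * (n : ℝ) ^ 2) : ℝ) : ℂ)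

/-- The state `U' ^ T |Φ₀⟩` of the search algorithm after `T` steps. -/
def stateAfter (n : ℕ) [NeZero n] (v : Vertex n) (T : ℕ) : Basis n → ℂ :=
  (markedWalk n v ^ T) *ᵥ uniformState n

/-- The probability that measuring the position register after `T` steps yields the marked
vertex `v`. -/
def successProb (n : ℕ) [NeZero n] (v : Vertex n) (T : ℕ) : ℝ :=
  ∑ i : Dir, ‖stateAfter n v T (i, v)‖ ^ 2

end GridWalk

end

/-! The proof bounds an Abel sum of overlaps from below, without spectral analysis. Let `U` be the
walk, `s` the state |s⟩⊗|v⟩ and `Φ` the uniform state, with r = ⟪s, Φ⟫ = 1/n. If `y` solves U y = z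
y + U s with z < 1, then ⟪y, Φ⟫ = ∑ zᵗ ⟪s, Uᵗ Φ⟫. Since U Φ = Φ + 2r U s, also Re ⟪y, Φ⟫ =
r(1+z)‖y‖² (`re_inner_resolvent`), so a large ‖y‖ forces a large overlap at an early time
(`exists_le_norm_inner_iterate`).

For ‖y‖ from below, ⟪s, p⟫ = ⟪y, p - z U p⟫ calls for a short, almost fixed `p` that overlaps `s`.
Twice a unit flow from v to the uniform distribution works: ‖p‖² = O(log n) is the energy of a flow
on the grid (`norm_sq_flowState_le`), and ‖p - U p‖ ≤ 2/n (`norm_sub_walkIsometry_le`). With 1 - z =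
1/√(N log N) this gives ‖y‖ ≥ n/16, hence an overlap of order 1/√(log N). -/

noncomputable section

namespace GridWalk

/-! ### Resolvent estimates for an isometry -/

section Isometry

variable {E : Type*} [NormedAddCommGroup E] [InnerProductSpace ℂ E]

/-- The resolvent equation of an isometry at a point inside the unit disc is solvable. -/
theorem exists_resolvent [FiniteDimensional ℂ E] (U : E →ₗᵢ[ℂ] E) (s : E) {z : ℝ}
    (hz0 : 0 ≤ z) (hz1 : z < 1) : ∃ y : E, U y = (z : ℂ) • y + s := by
  have hinj : Function.Injective (U.toLinearMap - (z : ℂ) • (LinearMap.id : E →ₗ[ℂ] E)) := by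
    rw [← LinearMap.ker_eq_bot, LinearMap.ker_eq_bot']
    intro y hy
    have h1 : U y = (z : ℂ) • y := by simpa [sub_eq_zero] using hy
    have h2 : ‖y‖ = z * ‖y‖ := by
      conv_lhs => rw [← U.norm_map y, h1, norm_smul, Complex.norm_real, Real.norm_of_nonneg hz0]
    have h3 := norm_nonneg y
    rw [← norm_eq_zero]
    nlinarith
  obtain ⟨y, hy⟩ := LinearMap.surjective_of_injective hinj s
  refine ⟨y, ?_⟩
  rw [← hy]
  simp

theorem inner_resolvent (U : E →ₗᵢ[ℂ] E) {s y : E} {z : ℝ}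
    (hy : U y = (z : ℂ) • y + U s) (x : E) :
    inner ℂ y x = inner ℂ s x + z * inner ℂ y (U x) := by
  rw [← U.inner_map_map y x, hy, inner_add_left, inner_smul_left, U.inner_map_map]
  simp [add_comm]

/-- In effect y = (1 - z U*)⁻¹ s, so pairing with `y` is an Abel sum, here cut off after `T` terms.
-/
theorem inner_resolvent_iterate (U : E →ₗᵢ[ℂ] E) {s y : E} {z : ℝ}
    (hy : U y = (z : ℂ) • y + U s) (x : E) (T : ℕ) :
    inner ℂ y x = ∑ t ∈ Finset.range T, (z : ℂ) ^ t * inner ℂ s (U^[t] x)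
      + (z : ℂ) ^ T * inner ℂ y (U^[T] x) := by
  induction T with
  | zero => simp
  | succ T ih =>
    rw [ih, Finset.sum_range_succ, inner_resolvent U hy (U^[T] x), Function.iterate_succ_apply' U T]
    ring

theorem norm_iterate (U : E →ₗᵢ[ℂ] E) (x : E) (T : ℕ) : ‖U^[T] x‖ = ‖x‖ := by
  induction T with
  | zero => rfl
  | succ T ih => rw [Function.iterate_succ_apply', U.norm_map, ih]

/-- If `U` almost fixes `Φ`, up to the multiple `2 r` of `U s` with `r = ⟪s, Φ⟫`, the resolvent
vector of `s` has norm controlled by its overlap with `Φ`. -/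
theorem re_inner_resolvent (U : E →ₗᵢ[ℂ] E) {s y Φ : E} {r z : ℝ} (hz1 : z < 1)
    (hy : U y = (z : ℂ) • y + U s) (hs : ‖s‖ = 1) (hr : inner ℂ s Φ = (r : ℂ))
    (hΦ : U Φ = Φ + ((2 * r : ℝ) : ℂ) • U s) :
    (inner ℂ y Φ).re = r * (1 + z) * ‖y‖ ^ 2 := by
  have e1 := congrArg Complex.re (inner_resolvent U hy Φ)
  rw [hΦ, inner_add_right, inner_smul_right, hr] at e1
  have e2 := congrArg Complex.re (inner_resolvent U hy s)
  have e3 := congrArg Complex.re (inner_resolvent U hy y)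
  rw [hy, inner_add_right, inner_smul_right, inner_self_eq_norm_sq_to_K] at e3
  rw [inner_self_eq_norm_sq_to_K, hs] at e2
  have e4 : (inner ℂ s y).re = (inner ℂ y s).re := by
    rw [← inner_conj_symm, Complex.conj_re]
  have e5 : (((‖y‖ : ℂ)) ^ 2).re = ‖y‖ ^ 2 := by
    rw [← Complex.ofReal_pow, Complex.ofReal_re]
  simp only [Complex.add_re, Complex.re_ofReal_mul, Complex.ofReal_re, Complex.coe_algebraMap,
    Complex.ofReal_one, one_pow, Complex.one_re, e4, e5] at e1 e2 e3
  -- Multiplied by 1 - z, both quantities equal r(1 + 2z Re ⟪y, U s⟫).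
  have : (1 - z) * ((inner ℂ y Φ).re - r * (1 + z) * ‖y‖ ^ 2) = 0 := by
    linear_combination e1 - r * e3 - r * e2
  rcases mul_eq_zero.1 this with h | h <;> linarith

/-- A lower bound for the overlap of `s` with some iterate of `Φ`, from a test vector `p`. -/
theorem exists_le_norm_inner_iterate [FiniteDimensional ℂ E] (U : E →ₗᵢ[ℂ] E) {s Φ p : E}
    {r z κ δ : ℝ} (hz0 : 0 ≤ z) (hz1 : z < 1) (hr0 : 0 < r) (hs : ‖s‖ = 1) (hΦ1 : ‖Φ‖ = 1)
    (hr : inner ℂ s Φ = (r : ℂ)) (hΦ : U Φ = Φ + ((2 * r : ℝ) : ℂ) • U s) (hκ : 0 ≤ κ)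
    (hδ0 : 0 ≤ δ)
    (hp : κ * ((1 - z) * ‖p‖ + ‖p - U p‖) ≤ ‖(inner ℂ s p : ℂ)‖)
    (hsp : inner ℂ s p ≠ (0 : ℂ)) (T : ℕ) (hδ : δ / (1 - z) + z ^ T / r < r * κ ^ 2) :
    ∃ t < T, δ ≤ ‖(inner ℂ s (U^[t] Φ) : ℂ)‖ := by
  obtain ⟨y, hy⟩ := exists_resolvent U (U s) hz0 hz1
  have hF := re_inner_resolvent U hz1 hy hs hr hΦ
  -- Cauchy–Schwarz turns the identity into r‖y‖² ≤ ‖y‖; this controls the tail of the Abel sum.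
  have hup : ‖y‖ ≤ 1 / r := by
    have h1 : (inner ℂ y Φ).re ≤ ‖y‖ := by
      simpa [hΦ1] using (Complex.re_le_norm _).trans (norm_inner_le_norm (𝕜 := ℂ) y Φ)
    rw [le_div_iff₀ hr0]
    rcases (norm_nonneg y).eq_or_lt with h0 | h0
    · rw [← h0]; simp
    · have : r * ‖y‖ ^ 2 ≤ ‖y‖ := by
        have : 0 ≤ r * z * ‖y‖ ^ 2 := by positivity
        nlinarith
      nlinarith
  have hlow : κ ≤ ‖y‖ := by
    have h1 : inner ℂ s p = inner ℂ y (p - (z : ℂ) • U p) := by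
      rw [inner_sub_right, inner_smul_right, inner_resolvent U hy p]; ring
    have h2 : ‖p - (z : ℂ) • U p‖ ≤ (1 - z) * ‖p‖ + ‖p - U p‖ := by
      have : p - (z : ℂ) • U p = ((1 - z : ℝ) : ℂ) • U p + (p - U p) := by
        push_cast; module
      rw [this]
      refine (norm_add_le _ _).trans ?_
      rw [norm_smul, U.norm_map, Complex.norm_real, Real.norm_of_nonneg (by linarith)]
    have h3 : ‖(inner ℂ s p : ℂ)‖ ≤ ‖y‖ * ((1 - z) * ‖p‖ + ‖p - U p‖) := by
      rw [h1]
      exact (norm_inner_le_norm _ _).trans (by gcongr)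
    have h4 : 0 < ‖(inner ℂ s p : ℂ)‖ := norm_pos_iff.2 hsp
    have h5 : 0 < (1 - z) * ‖p‖ + ‖p - U p‖ := by
      by_contra! h
      nlinarith [norm_nonneg y]
    exact le_of_mul_le_mul_right (hp.trans h3) h5
  -- If all overlaps were below `δ`, the Abel sum would be at most δ/(1-z) plus the tail, less than
  -- rκ² ≤ r‖y‖².
  by_contra! hcon
  have h1 : (inner ℂ y Φ).re ≤ δ / (1 - z) + z ^ T / r := by
    refine (Complex.re_le_norm _).trans ?_
    rw [inner_resolvent_iterate U hy Φ T]
    refine (norm_add_le _ _).trans (add_le_add ?_ ?_)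
    · refine (norm_sum_le _ _).trans ?_
      have h2 : ∀ t ∈ Finset.range T,
          ‖(z : ℂ) ^ t * inner ℂ s (U^[t] Φ)‖ ≤ δ * z ^ t := by
        intro t ht
        rw [norm_mul, norm_pow, Complex.norm_real, Real.norm_of_nonneg hz0, mul_comm]
        gcongr
        exact (hcon t (Finset.mem_range.1 ht)).le
      refine (Finset.sum_le_sum h2).trans ?_
      rw [← Finset.mul_sum, geom_sum_eq hz1.ne, div_eq_mul_inv]
      rw [div_eq_mul_inv δ]
      refine mul_le_mul_of_nonneg_left ?_ hδ0
      rw [← div_eq_mul_inv, ← neg_div_neg_eq, div_eq_mul_inv, neg_sub, neg_sub]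
      have : 0 < (1 - z)⁻¹ := inv_pos.2 (by linarith)
      nlinarith [pow_nonneg hz0 T]
    · rw [norm_mul, norm_pow, Complex.norm_real, Real.norm_of_nonneg hz0, div_eq_mul_one_div]
      gcongr
      refine (norm_inner_le_norm _ _).trans ?_
      rw [norm_iterate, hΦ1, mul_one]
      exact hup
  have h2 : r * κ ^ 2 ≤ (inner ℂ y Φ).re := by
    rw [hF]
    have : κ ^ 2 ≤ ‖y‖ ^ 2 := by gcongr
    have : 0 ≤ r * z * ‖y‖ ^ 2 := by positivity
    nlinarith
  linarith

end Isometry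

/-! ### A unit flow of logarithmic energy -/

/-- Horizontal part of a flow on `[0, n)²` from the origin to the uniform distribution: spread
uniformly over antidiagonals up to the antidiagonal `a + b + 1 = n`, and from there
uniformly over each row. -/
def flowRight (n a b : ℕ) : ℝ :=
  (if a + b + 2 ≤ n then (a + 1 : ℝ) / ((a + b + 1) * (a + b + 2)) else 1 / n) - (a + 1) / n ^ 2

/-- Vertical part of the flow `flowRight`. -/
def flowUp (n a b : ℕ) : ℝ :=
  if a + b + 2 ≤ n then (b + 1 : ℝ) / ((a + b + 1) * (a + b + 2)) else 0

theorem flowRight_sq_le {n a b : ℕ} (ha : a < n) :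
    flowRight n a b ^ 2 ≤ 1 / (a + b + 1 : ℝ) ^ 2 + 1 / n ^ 2 := by
  have hn : (0 : ℝ) < n := by exact_mod_cast (Nat.zero_le a).trans_lt ha
  have ha' : (a + 1 : ℝ) ≤ n := by exact_mod_cast ha
  have h0 : (0 : ℝ) ≤ (a + 1) / n ^ 2 := by positivity
  unfold flowRight
  split_ifs with h
  · have h' : (a + b + 2 : ℝ) ≤ n := by exact_mod_cast h
    have h1 : (a + 1 : ℝ) / ((a + b + 1) * (a + b + 2)) ≤ 1 / (a + b + 1) := by
      rw [div_le_div_iff₀ (by positivity) (by positivity)]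
      nlinarith [show (0 : ℝ) ≤ (b + 1) * (a + b + 1) by positivity]
    have h2 : (a + 1 : ℝ) / n ^ 2 ≤ (a + 1) / ((a + b + 1) * (a + b + 2)) := by
      gcongr
      nlinarith [show (0 : ℝ) ≤ a + b + 1 by positivity]
    have h3 : ((a + 1 : ℝ) / ((a + b + 1) * (a + b + 2)) - (a + 1) / n ^ 2) ^ 2
        ≤ (1 / (a + b + 1)) ^ 2 := by
      apply pow_le_pow_left₀ <;> linarith
    rw [div_pow, one_pow] at h3
    have : (0 : ℝ) ≤ 1 / n ^ 2 := by positivity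
    linarith
  · have h2 : (a + 1 : ℝ) / n ^ 2 ≤ 1 / n := by
      rw [div_le_div_iff₀ (by positivity) (by positivity)]
      nlinarith
    have h3 : (1 / n - (a + 1 : ℝ) / n ^ 2) ^ 2 ≤ (1 / n) ^ 2 := by
      apply pow_le_pow_left₀ <;> linarith
    rw [div_pow, one_pow] at h3
    have : (0 : ℝ) ≤ 1 / (a + b + 1 : ℝ) ^ 2 := by positivity
    linarith

theorem flowUp_sq_le (n a b : ℕ) : flowUp n a b ^ 2 ≤ 1 / (a + b + 1 : ℝ) ^ 2 := by
  unfold flowUp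
  split_ifs with h
  · have h1 : (b + 1 : ℝ) / ((a + b + 1) * (a + b + 2)) ≤ 1 / (a + b + 1) := by
      rw [div_le_div_iff₀ (by positivity) (by positivity)]
      nlinarith [show (0 : ℝ) ≤ (a + 1) * (a + b + 1) by positivity]
    have h3 : ((b + 1 : ℝ) / ((a + b + 1) * (a + b + 2))) ^ 2 ≤ (1 / (a + b + 1)) ^ 2 := by
      gcongr
    rwa [div_pow (1 : ℝ), one_pow] at h3
  · simp; positivity

theorem sum_one_div_add_sq_le (n a : ℕ) :
    ∑ b ∈ Finset.range n, 1 / (a + b + 1 : ℝ) ^ 2 ≤ 2 * (a + 1 : ℝ)⁻¹ := by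
  suffices h : ∑ b ∈ Finset.range n, 1 / (a + b + 1 : ℝ) ^ 2
      ≤ 2 * ((a + 1 : ℝ)⁻¹ - (a + n + 1 : ℝ)⁻¹) by
    have : (0 : ℝ) ≤ (a + n + 1 : ℝ)⁻¹ := by positivity
    linarith
  induction n with
  | zero => simp
  | succ n ih =>
    rw [Finset.sum_range_succ]
    -- Telescoping: 1/m² ≤ 2/(m(m+1)).
    have : 1 / (a + n + 1 : ℝ) ^ 2 ≤ 2 * ((a + n + 1 : ℝ)⁻¹ - (a + (n + 1) + 1 : ℝ)⁻¹) := by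
      rw [show 2 * ((a + n + 1 : ℝ)⁻¹ - (a + (n + 1) + 1 : ℝ)⁻¹)
        = 2 / ((a + n + 1) * (a + n + 2)) by field_simp; ring,
        div_le_div_iff₀ (by positivity) (by positivity)]
      nlinarith [show (0 : ℝ) ≤ (a + n) * (a + n + 1) by positivity]
    push_cast
    linarith

theorem sum_sum_one_div_add_sq_le (n : ℕ) :
    ∑ a ∈ Finset.range n, ∑ b ∈ Finset.range n, 1 / (a + b + 1 : ℝ) ^ 2
      ≤ 2 * (1 + Real.log n) := by
  refine (Finset.sum_le_sum fun a _ => sum_one_div_add_sq_le n a).trans ?_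
  rw [← Finset.mul_sum]
  gcongr
  simpa [harmonic] using harmonic_le_one_add_log n

/-- No flow crosses the periodic seam, so one formula also covers a = 0; at the origin it relies on
0/0 = 0. -/
theorem flowRight_pred {n a b : ℕ} (ha : a < n) (hb : b < n) :
    flowRight n (if a = 0 then n - 1 else a - 1) b
      = (if a + b + 1 ≤ n then (a : ℝ) / ((a + b) * (a + b + 1)) else 1 / n) - a / n ^ 2 := by
  have hn : (n : ℝ) ≠ 0 := by
    have : n ≠ 0 := by omega
    exact_mod_cast this
  rcases a with _ | a
  · rw [if_pos rfl, flowRight, if_neg (by omega), if_pos (by omega), Nat.cast_sub (by omega)]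
    simp
    field_simp
    simp
  · simp only [Nat.add_eq_zero_iff, one_ne_zero, and_false, if_false, Nat.add_sub_cancel,
      flowRight, add_right_comm a 1 b]
    push_cast
    simp only [add_right_comm (a : ℝ) 1 (b : ℝ), add_assoc (a + b : ℝ) 1 1, one_add_one_eq_two]

theorem flowUp_pred {n a b : ℕ} (hb : b < n) :
    flowUp n a (if b = 0 then n - 1 else b - 1)
      = if a + b + 1 ≤ n then (b : ℝ) / ((a + b) * (a + b + 1)) else 0 := by
  rcases b with _ | b
  · rw [if_pos rfl, flowUp, if_neg (by omega)]
    simp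
  · simp only [Nat.add_eq_zero_iff, one_ne_zero, and_false, if_false, Nat.add_sub_cancel,
      flowUp, ← add_assoc a b 1]
    push_cast
    simp only [← add_assoc (a : ℝ) (b : ℝ) 1, add_assoc (a + b : ℝ) 1 1, one_add_one_eq_two]

/-- The flow has a unit source at the origin and uniform sinks. -/
theorem flow_div {n a b : ℕ} (ha : a < n) (hb : b < n) :
    flowRight n a b - flowRight n (if a = 0 then n - 1 else a - 1) b
      + (flowUp n a b - flowUp n a (if b = 0 then n - 1 else b - 1))
      = (if a = 0 ∧ b = 0 then 1 else 0) - 1 / (n : ℝ) ^ 2 := by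
  have hn : (n : ℝ) ≠ 0 := by
    have : n ≠ 0 := by omega
    exact_mod_cast this
  rw [flowRight_pred ha hb, flowUp_pred hb, flowRight, flowUp]
  have e : ((a : ℝ) + 1) / n ^ 2 = a / n ^ 2 + 1 / n ^ 2 := add_div _ _ _
  rw [e]
  have h2 : (a + b + 2 : ℝ) ≠ 0 := by positivity
  have h1 : (a + b + 1 : ℝ) ≠ 0 := by positivity
  have o1 : (a + 1 : ℝ) / ((a + b + 1) * (a + b + 2)) + (b + 1) / ((a + b + 1) * (a + b + 2))
      = 1 / (a + b + 1) := by
    field_simp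
    ring
  by_cases h0 : a = 0 ∧ b = 0
  · obtain ⟨rfl, rfl⟩ := h0
    by_cases hd : 0 + 0 + 2 ≤ n
    · rw [if_pos hd, if_pos (by omega), if_pos hd]
      norm_num
      ring
    · obtain rfl : n = 1 := by omega
      norm_num
  · have h0' : (a + b : ℝ) ≠ 0 := by
      have : a + b ≠ 0 := by omega
      exact_mod_cast this
    have o2 : (a : ℝ) / ((a + b) * (a + b + 1)) + b / ((a + b) * (a + b + 1))
        = 1 / (a + b + 1) := by
      field_simp
    rw [if_neg h0]
    -- Three regimes: before the antidiagonal a + b + 1 = n, on it (inflow 1/n, passed on along the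
    -- row), and beyond it.
    by_cases hd : a + b + 2 ≤ n
    · rw [if_pos hd, if_pos (by omega), if_pos hd, if_pos (by omega)]
      linear_combination o1 - o2
    · rw [if_neg hd, if_neg hd]
      by_cases hd' : a + b + 1 ≤ n
      · have hn' : (n : ℝ) = a + b + 1 := by
          have : n = a + b + 1 := by omega
          exact_mod_cast this
        rw [if_pos hd', if_pos hd', ← hn']
        rw [← hn'] at o2
        linear_combination -o2
      · rw [if_neg hd', if_neg hd']
        ring

/-! ### The walk in coordinates, as an isometry -/

theorem val_sub_one {n : ℕ} [NeZero n] (y : ZMod n) :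
    (y - 1).val = if y.val = 0 then n - 1 else y.val - 1 := by
  obtain ⟨m, rfl⟩ : ∃ m, n = m + 1 := ⟨n - 1, by have := NeZero.pos n; omega⟩
  split_ifs with h
  · rw [(ZMod.val_eq_zero y).1 h, zero_sub, ZMod.val_neg_one]; rfl
  · have h1 : y - 1 = ((y.val - 1 : ℕ) : ZMod (m + 1)) := by
      rw [Nat.cast_sub (by omega)]; simp
    rw [h1, ZMod.val_cast_of_lt]
    have := ZMod.val_lt y
    omega

theorem sum_zmod_val {n : ℕ} [NeZero n] (f : ℕ → ℝ) :
    ∑ y : ZMod n, f y.val = ∑ a ∈ Finset.range n, f a := by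
  obtain ⟨m, rfl⟩ : ∃ m, n = m + 1 := ⟨n - 1, by have := NeZero.pos n; omega⟩
  exact Fin.sum_univ_eq_sum_range f (m + 1)

theorem Dir.flip_flip (i : Dir) : i.flip.flip = i := by cases i <;> rfl

theorem Dir.step_flip (n : ℕ) (i : Dir) : i.flip.step n = -i.step n := by
  cases i <;> simp [Dir.flip, Dir.step]

theorem sum_dir {M : Type*} [AddCommMonoid M] (f : Dir → M) :
    ∑ i, f i = f .right + (f .left + (f .up + f .down)) := by
  change ∑ i ∈ ({.right, .left, .up, .down} : Finset Dir), f i = _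
  simp

/-- Traversing an edge, as an involution of the basis. -/
def edgeSwap (n : ℕ) : Basis n ≃ Basis n where
  toFun b := (b.1.flip, b.2 + b.1.step n)
  invFun b := (b.1.flip, b.2 + b.1.step n)
  left_inv b := by simp [Dir.flip_flip, Dir.step_flip]
  right_inv b := by simp [Dir.flip_flip, Dir.step_flip]

variable {n : ℕ} [NeZero n]

theorem flipFlopShift_mulVec (φ : Basis n → ℂ) (b : Basis n) :
    (flipFlopShift n *ᵥ φ) b = φ (edgeSwap n b) := by
  have h : ∀ a : Basis n, b = (a.1.flip, a.2 + a.1.step n) ↔ a = edgeSwap n b := by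
    intro a
    refine Iff.trans ?_ (edgeSwap n).symm_apply_eq
    exact eq_comm
  simp only [Matrix.mulVec, dotProduct, flipFlopShift, Matrix.of_apply, h]
  simp

theorem groverCoin_apply (i j : Dir) :
    groverCoin i j = 1 / 2 - (1 : Matrix Dir Dir ℂ) i j := by
  have h : √(4 : ℝ) = 2 := by
    rw [show (4 : ℝ) = 2 ^ 2 by norm_num, Real.sqrt_sq (by norm_num)]
  simp [groverCoin, Matrix.vecMulVec_apply, coinState, h]

theorem markedCoin_mulVec (v : Vertex n) (ψ : Basis n → ℂ) (i : Dir) (x : Vertex n) :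
    (markedCoin n v *ᵥ ψ) (i, x) =
      (if x = v then 0 else 1 / 2 * ∑ j, ψ (j, x)) - ψ (i, x) := by
  have h : ∀ j, ∑ y, markedCoin n v (i, x) (j, y) * ψ (j, y)
      = (if x = v then 0 else 1 / 2 * ψ (j, x)) - (1 : Matrix Dir Dir ℂ) i j * ψ (j, x) := by
    intro j
    rw [Finset.sum_eq_single x]
    · by_cases hx : x = v
      · subst hx
        simp [markedCoin, vertexProj, markingCoin]
      · simp [markedCoin, vertexProj, hx, Ne.symm hx, groverCoin_apply, sub_mul]
    · intro y _ hy
      have : vertexProj n v x y = 0 := by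
        simp only [vertexProj, Matrix.single_apply]
        rw [if_neg]
        rintro ⟨rfl, rfl⟩
        exact hy rfl
      simp [markedCoin, this, Matrix.one_apply_ne hy.symm]
    · simp
  simp only [Matrix.mulVec, dotProduct, Fintype.sum_prod_type, h, Finset.sum_sub_distrib]
  congr 1
  · split_ifs
    · simp
    · rw [Finset.mul_sum]
  · simp [Matrix.one_apply]

theorem markedWalk_mulVec (v : Vertex n) (ψ : Basis n → ℂ) (j : Dir) (x : Vertex n) :
    (markedWalk n v *ᵥ ψ) (j, x) =
      (if x + j.step n = v then 0 else 1 / 2 * ∑ i, ψ (i, x + j.step n))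
        - ψ (j.flip, x + j.step n) := by
  rw [markedWalk, ← Matrix.mulVec_mulVec, flipFlopShift_mulVec]
  exact markedCoin_mulVec v ψ _ _

/-- The shift permutes the basis, and the coin at each vertex is -1 or the reflection about the
mean. -/
theorem sum_norm_sq_markedWalk (v : Vertex n) (ψ : Basis n → ℂ) :
    ∑ b, ‖(markedWalk n v *ᵥ ψ) b‖ ^ 2 = ∑ b, ‖ψ b‖ ^ 2 := by
  simp only [markedWalk, ← Matrix.mulVec_mulVec, flipFlopShift_mulVec]
  rw [Equiv.sum_comp (edgeSwap n) fun b => ‖(markedCoin n v *ᵥ ψ) b‖ ^ 2,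
    Fintype.sum_prod_type_right,
    Fintype.sum_prod_type_right (f := fun b => ‖ψ b‖ ^ 2)]
  refine Finset.sum_congr rfl fun x _ => ?_
  simp only [markedCoin_mulVec]
  split_ifs
  · simp
  · simp only [sum_dir, ← Complex.normSq_eq_norm_sq, Complex.normSq_apply]
    simp
    ring

/-- The walk as an isometry of the Hilbert space of coin and vertices. -/
def walkIsometry (v : Vertex n) :
    EuclideanSpace ℂ (Basis n) →ₗᵢ[ℂ] EuclideanSpace ℂ (Basis n) where
  toLinearMap := Matrix.toEuclideanLin (markedWalk n v)
  norm_map' ψ := by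
    rw [EuclideanSpace.norm_eq, EuclideanSpace.norm_eq]
    congr 1
    exact sum_norm_sq_markedWalk v ψ.ofLp

theorem walkIsometry_toLp (v : Vertex n) (ψ : Basis n → ℂ) :
    walkIsometry v (WithLp.toLp 2 ψ) = WithLp.toLp 2 (markedWalk n v *ᵥ ψ) := rfl

theorem walkIsometry_iterate (v : Vertex n) (T : ℕ) :
    (walkIsometry v)^[T] (WithLp.toLp 2 (uniformState n)) = WithLp.toLp 2 (stateAfter n v T) := by
  induction T with
  | zero => simp [stateAfter]
  | succ T ih =>
    rw [Function.iterate_succ_apply', ih, walkIsometry_toLp, stateAfter, stateAfter,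
      Matrix.mulVec_mulVec, ← pow_succ']

/-- The state `|s⟩ ⊗ |v⟩`. -/
def markedState (v : Vertex n) : Basis n → ℂ := fun b => if b.2 = v then 1 / 2 else 0

theorem inner_markedState (v : Vertex n) (ψ : Basis n → ℂ) :
    inner ℂ (WithLp.toLp 2 (markedState v)) (WithLp.toLp 2 ψ) = 1 / 2 * ∑ i, ψ (i, v) := by
  rw [EuclideanSpace.inner_toLp_toLp, dotProduct, Fintype.sum_prod_type, Finset.mul_sum]
  refine Finset.sum_congr rfl fun i _ => ?_
  rw [Finset.sum_eq_single v]
  · simp [markedState, mul_comm]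
  · intro x _ hx
    simp [markedState, hx]
  · simp

theorem norm_markedState (v : Vertex n) : ‖WithLp.toLp 2 (markedState v)‖ = 1 := by
  have h : (inner ℂ (WithLp.toLp 2 (markedState v)) (WithLp.toLp 2 (markedState v)) : ℂ) = 1 := by
    rw [inner_markedState, sum_dir]
    simp [markedState]
    norm_num
  rw [inner_self_eq_norm_sq_to_K] at h
  have h2 : ‖WithLp.toLp 2 (markedState v)‖ ^ 2 = 1 := by
    have h3 : (((‖WithLp.toLp 2 (markedState v)‖ ^ 2 : ℝ)) : ℂ) = 1 := by
      rw [Complex.ofReal_pow]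
      exact h
    exact Complex.ofReal_eq_one.1 h3
  exact (pow_eq_one_iff_of_nonneg (norm_nonneg _) two_ne_zero).1 h2

theorem uniformState_apply {n : ℕ} (b : Basis n) : uniformState n b = 1 / (2 * (n : ℂ)) := by
  have h : √(4 * (n : ℝ) ^ 2) = 2 * n := by
    rw [show (4 * (n : ℝ) ^ 2) = (2 * n) ^ 2 by ring, Real.sqrt_sq (by positivity)]
  simp [uniformState, h]

theorem norm_uniformState : ‖WithLp.toLp 2 (uniformState n)‖ = 1 := by
  have hn : (n : ℝ) ≠ 0 := NeZero.ne _
  rw [EuclideanSpace.norm_eq]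
  simp only [uniformState_apply, Finset.sum_const, Finset.card_univ, Fintype.card_prod, ZMod.card]
  have : Fintype.card Dir = 4 := rfl
  rw [this, Real.sqrt_eq_one]
  simp
  field_simp
  norm_num

theorem inner_markedState_uniformState (v : Vertex n) :
    inner ℂ (WithLp.toLp 2 (markedState v)) (WithLp.toLp 2 (uniformState n))
      = (((1 / n : ℝ)) : ℂ) := by
  have hn : (n : ℂ) ≠ 0 := NeZero.ne _
  rw [inner_markedState, sum_dir]
  simp only [uniformState_apply]
  push_cast
  field_simp
  norm_num

/-- As -I = C₀(I - 2|s⟩⟨s|) - 2(C₀ - |s⟩⟨s|)(I - |s⟩⟨s|) - 2(I - |s⟩⟨s|) on the coin space, only the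
|s⟩ component matters here: the unmarked walk fixes `Φ`, and marking reverses the sign of the image
of |s⟩⊗|v⟩. -/
theorem walkIsometry_uniformState (v : Vertex n) :
    walkIsometry v (WithLp.toLp 2 (uniformState n)) = WithLp.toLp 2 (uniformState n)
      + ((2 * (1 / n) : ℝ) : ℂ) • walkIsometry v (WithLp.toLp 2 (markedState v)) := by
  have hn : (n : ℂ) ≠ 0 := NeZero.ne _
  ext ⟨j, x⟩
  simp only [walkIsometry_toLp, PiLp.add_apply, PiLp.smul_apply, markedWalk_mulVec,
    uniformState_apply, sum_dir, markedState, smul_eq_mul]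
  push_cast
  split_ifs
  · field_simp
    norm_num
  · field_simp
    norm_num

/-- The probability at `v` dominates the overlap with `|s⟩ ⊗ |v⟩`. -/
theorem norm_inner_sq_le_successProb (v : Vertex n) (T : ℕ) :
    ‖(inner ℂ (WithLp.toLp 2 (markedState v)) (WithLp.toLp 2 (stateAfter n v T)) : ℂ)‖ ^ 2
      ≤ successProb n v T := by
  rw [inner_markedState, norm_mul, successProb, mul_pow]
  have h1 : ‖∑ i, stateAfter n v T (i, v)‖ ^ 2 ≤ 4 * ∑ i, ‖stateAfter n v T (i, v)‖ ^ 2 :=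
    calc _ ≤ (∑ i, ‖stateAfter n v T (i, v)‖) ^ 2 := by gcongr; exact norm_sum_le _ _
      _ ≤ _ := by
        simpa using! sq_sum_le_card_mul_sum_sq (s := (Finset.univ : Finset Dir))
          (f := fun i => ‖stateAfter n v T (i, v)‖)
  norm_num at h1 ⊢
  linarith

/-- Translations carry the walk marked at 0 to the walk marked at `v`; hence one `T` serves every
`v`. -/
theorem stateAfter_translate (v : Vertex n) (T : ℕ) (i : Dir) (x : Vertex n) :
    stateAfter n v T (i, x) = stateAfter n 0 T (i, x - v) := by
  induction T generalizing i x with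
  | zero => simp [stateAfter, uniformState]
  | succ T ih =>
    have h : ∀ w, stateAfter n w (T + 1) = markedWalk n w *ᵥ stateAfter n w T := by
      intro w
      rw [stateAfter, stateAfter, Matrix.mulVec_mulVec, ← pow_succ']
    rw [h, h, markedWalk_mulVec, markedWalk_mulVec]
    simp only [ih, sub_add_eq_add_sub, sub_eq_zero]

theorem successProb_eq (v : Vertex n) (T : ℕ) : successProb n v T = successProb n 0 T := by
  simp only [successProb, stateAfter_translate v, sub_self]

/-! ### The flow as a test vector -/

/-- A unit flow on the edges, from `v` to the uniform distribution, scaled by two, moves little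
under the walk. -/
theorem norm_sub_walkIsometry_le (v : Vertex n) (p : Basis n → ℂ)
    (hanti : ∀ i x, p (i.flip, x + i.step n) = -p (i, x))
    (hdiv : ∀ x, ∑ i, p (i, x) = 2 * ((if x = v then 1 else 0) - 1 / (n : ℂ) ^ 2)) :
    ‖WithLp.toLp 2 p - walkIsometry v (WithLp.toLp 2 p)‖ ≤ 2 / n := by
  have hn : (0 : ℝ) < n := Nat.cast_pos.2 (NeZero.pos n)
  have h : ∀ b, ‖(WithLp.toLp 2 p - walkIsometry v (WithLp.toLp 2 p)) b‖ ^ 2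
      ≤ 1 / (n : ℝ) ^ 4 := by
    rintro ⟨j, x⟩
    rw [walkIsometry_toLp, PiLp.sub_apply]
    change ‖p (j, x) - (markedWalk n v *ᵥ p) (j, x)‖ ^ 2 ≤ _
    -- Antisymmetry cancels p(j, x), leaving half the divergence at the far end: 1/n² in modulus, or
    -- nothing if that end is `v`, where the coin has no mean term.
    rw [markedWalk_mulVec, hdiv, hanti]
    split_ifs with hx
    · simp
    · simp
      apply le_of_eq
      ring
  rw [EuclideanSpace.norm_eq]
  apply Real.sqrt_le_iff.2 ⟨by positivity, (Finset.sum_le_sum fun b _ => h b).trans _⟩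
  simp only [Finset.sum_const, Finset.card_univ, Fintype.card_prod, ZMod.card]
  have : Fintype.card Dir = 4 := rfl
  rw [this]
  simp
  apply le_of_eq
  field_simp
  norm_num

/-- Twice the flow, as an antisymmetric function on the directed edges, with source `v`. -/
def flowState {n : ℕ} (v : Vertex n) : Basis n → ℂ
  | (.right, x) => ((2 * flowRight n (x - v).1.val (x - v).2.val : ℝ) : ℂ)
  | (.left, x) => -((2 * flowRight n ((x - v).1 - 1).val (x - v).2.val : ℝ) : ℂ)
  | (.up, x) => ((2 * flowUp n (x - v).1.val (x - v).2.val : ℝ) : ℂ)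
  | (.down, x) => -((2 * flowUp n (x - v).1.val ((x - v).2 - 1).val : ℝ) : ℂ)

theorem flowState_flip {n : ℕ} (v : Vertex n) (i : Dir) (x : Vertex n) :
    flowState v (i.flip, x + i.step n) = -flowState v (i, x) := by
  cases i <;> simp [Dir.flip, Dir.step, flowState, add_sub_right_comm, ← sub_eq_add_neg]

theorem sum_flowState (v x : Vertex n) :
    ∑ i, flowState v (i, x) = 2 * ((if x = v then 1 else 0) - 1 / (n : ℂ) ^ 2) := by
  have h := flow_div (ZMod.val_lt (x - v).1) (ZMod.val_lt (x - v).2)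
  rw [← val_sub_one, ← val_sub_one] at h
  have h1 : ((x - v).1.val = 0 ∧ (x - v).2.val = 0) ↔ x = v := by
    rw [ZMod.val_eq_zero, ZMod.val_eq_zero, ← sub_eq_zero (a := x), Prod.ext_iff]; rfl
  simp only [h1] at h
  have h2 := congrArg (fun t : ℝ => (2 * t : ℂ)) h
  simp only [sum_dir, flowState]
  have h3 : (((if x = v then 1 else 0 : ℝ)) : ℂ) = if x = v then 1 else 0 := by
    split_ifs <;> simp
  push_cast [h3] at h2 ⊢
  rw [← h2]
  ring

theorem norm_sq_flowState_le (v : Vertex n) :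
    ‖WithLp.toLp 2 (flowState v)‖ ^ 2 ≤ 8 * (5 + 4 * Real.log n) := by
  have hn : (n : ℝ) ≠ 0 := NeZero.ne _
  have key : ∀ f : ZMod n → ZMod n → ℝ, ∑ x : Vertex n, f (x - v).1 (x - v).2
      = ∑ a, ∑ b, f a b := by
    intro f
    exact ((Equiv.subRight v).sum_comp fun x : Vertex n => f x.1 x.2).trans
      (Fintype.sum_prod_type _)
  have hR : ∑ a : ZMod n, ∑ b : ZMod n, flowRight n a.val b.val ^ 2
      ≤ 2 * (1 + Real.log n) + 1 := by
    refine le_trans ?_ (add_le_add_left (sum_sum_one_div_add_sq_le n) 1)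
    have h1 : ∑ a ∈ Finset.range n, ∑ b ∈ Finset.range n, 1 / (n : ℝ) ^ 2 = 1 := by
      simp; field_simp
    refine le_trans ?_ (add_le_add_right h1.le _)
    rw [← Finset.sum_add_distrib]
    simp only [← Finset.sum_add_distrib]
    rw [← sum_zmod_val]
    refine Finset.sum_le_sum fun a _ => ?_
    rw [← sum_zmod_val]
    exact Finset.sum_le_sum fun b _ => flowRight_sq_le (ZMod.val_lt a)
  have hU : ∑ a : ZMod n, ∑ b : ZMod n, flowUp n a.val b.val ^ 2
      ≤ 2 * (1 + Real.log n) := by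
    refine le_trans ?_ (sum_sum_one_div_add_sq_le n)
    rw [← sum_zmod_val]
    refine Finset.sum_le_sum fun a _ => ?_
    rw [← sum_zmod_val]
    exact Finset.sum_le_sum fun b _ => flowUp_sq_le n _ _
  have hL : ∑ a : ZMod n, ∑ b : ZMod n, flowRight n (a - 1).val b.val ^ 2
      = ∑ a : ZMod n, ∑ b : ZMod n, flowRight n a.val b.val ^ 2 :=
    (Equiv.subRight (1 : ZMod n)).sum_comp fun a => ∑ b : ZMod n, flowRight n a.val b.val ^ 2
  have hD : ∑ a : ZMod n, ∑ b : ZMod n, flowUp n a.val (b - 1).val ^ 2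
      = ∑ a : ZMod n, ∑ b : ZMod n, flowUp n a.val b.val ^ 2 :=
    Finset.sum_congr rfl fun a _ =>
      (Equiv.subRight (1 : ZMod n)).sum_comp fun b => flowUp n a.val b.val ^ 2
  rw [EuclideanSpace.norm_eq, Real.sq_sqrt (by positivity), Fintype.sum_prod_type, sum_dir]
  simp only [flowState, norm_neg, Complex.norm_real, Real.norm_eq_abs, sq_abs, mul_pow,
    ← Finset.mul_sum]
  rw [key fun a b => flowRight n a.val b.val ^ 2, key fun a b => flowRight n (a - 1).val b.val ^ 2,
    key fun a b => flowUp n a.val b.val ^ 2, key fun a b => flowUp n a.val (b - 1).val ^ 2, hL, hD]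
  linarith

theorem inner_markedState_flowState (v : Vertex n) :
    inner ℂ (WithLp.toLp 2 (markedState v)) (WithLp.toLp 2 (flowState v))
      = ((1 - 1 / (n : ℝ) ^ 2 : ℝ) : ℂ) := by
  rw [inner_markedState, sum_flowState, if_pos rfl]
  push_cast
  ring

/-! ### Choice of the constants -/

/-- Some step among the first `O(√(N log N))` has success probability `Ω(1 / log N)`. -/
theorem exists_le_successProb (hn : 2 ≤ n) :
    ∃ T : ℕ, (T : ℝ) ≤ 8 * √((n : ℝ) ^ 2 * Real.log ((n : ℝ) ^ 2)) ∧
      1 / 2 ^ 18 / Real.log ((n : ℝ) ^ 2) ≤ successProb n 0 T := by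
  set L := Real.log ((n : ℝ) ^ 2) with hL
  have hn2 : (2 : ℝ) ≤ n := by exact_mod_cast hn
  have hn0 : (0 : ℝ) < n := by linarith
  have hLn : L = 2 * Real.log n := by rw [hL, Real.log_pow]; norm_num
  have hL1 : 5 / 4 ≤ L := by
    have h1 : Real.log 2 ≤ Real.log n := Real.log_le_log (by norm_num) hn2
    have := Real.log_two_gt_d9
    rw [hLn]
    linarith
  have hL0 : 0 < L := by linarith
  have hsL : 1 ≤ √L := Real.one_le_sqrt.2 (by linarith)
  have hsq : √L ^ 2 = L := Real.sq_sqrt hL0.le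
  have hroot : √((n : ℝ) ^ 2 * L) = n * √L := by
    rw [Real.sqrt_mul (by positivity), Real.sqrt_sq hn0.le]
  set M := (n : ℝ) * √L with hM
  have hM2 : 2 ≤ M := by nlinarith
  have hM0 : 0 < M := by linarith
  -- This scale balances (1-z)‖p‖ ≤ 8/n against ‖p - U p‖ ≤ 2/n.
  set z := 1 - 1 / M with hz
  have hz0 : 0 ≤ z := by
    rw [hz, sub_nonneg, div_le_one hM0]; linarith
  have hz1 : z < 1 := by
    have : 0 < 1 / M := by positivity
    linarith
  have h1z : 1 - z = 1 / M := by rw [hz]; ring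
  have hnorm : ‖WithLp.toLp 2 (flowState (0 : Vertex n))‖ ≤ 8 * √L := by
    refine (pow_le_pow_iff_left₀ (norm_nonneg _) (by positivity) two_ne_zero).1 ?_
    refine (norm_sq_flowState_le 0).trans ?_
    rw [mul_pow, hsq]
    linarith
  have hmove := norm_sub_walkIsometry_le (0 : Vertex n) _ (flowState_flip 0) (sum_flowState 0)
  have hsp := inner_markedState_flowState (0 : Vertex n)
  have hN : 3 / 4 ≤ 1 - 1 / (n : ℝ) ^ 2 := by
    have : 1 / (n : ℝ) ^ 2 ≤ 1 / 2 ^ 2 := by gcongr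
    linarith
  -- κ · 10/n = 10/16 stays below ⟪s, p⟫ ≥ 3/4, and `δ` makes δ/(1-z) = n/512, half of rκ² = n/256.
  obtain ⟨t, ht, hδ⟩ := exists_le_norm_inner_iterate (walkIsometry (0 : Vertex n))
    (κ := n / 16) (δ := 1 / (512 * √L)) hz0 hz1 (r := 1 / n) (by positivity) (norm_markedState 0)
    norm_uniformState (inner_markedState_uniformState 0) (walkIsometry_uniformState 0)
    (by positivity) (by positivity) (p := WithLp.toLp 2 (flowState 0))
    (by
      rw [hsp, Complex.norm_real, Real.norm_of_nonneg (by linarith), h1z]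
      have h1 : 1 / M * ‖WithLp.toLp 2 (flowState (0 : Vertex n))‖ ≤ 8 / n := by
        refine (mul_le_mul_of_nonneg_left hnorm (by positivity)).trans_eq ?_
        rw [hM]
        field_simp
      refine (mul_le_mul_of_nonneg_left (add_le_add h1 hmove) (by positivity)).trans ?_
      refine le_trans (le_of_eq ?_) (show (10 / 16 : ℝ) ≤ _ by linarith)
      field_simp
      norm_num)
    (by
      rw [hsp]
      exact_mod_cast (by linarith : (0 : ℝ) < 1 - 1 / (n : ℝ) ^ 2).ne')
    -- e⁻⁷ < 1/1024 brings the tail below n/1024, and 7M + 1 ≤ 8M.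
    ⌈7 * M⌉₊
    (by
      have hzT : z ^ ⌈7 * M⌉₊ < 1 / 1024 := by
        have h1 : z ≤ Real.exp (-(1 / M)) := by
          have := Real.add_one_le_exp (-(1 / M))
          linarith
        calc z ^ ⌈7 * M⌉₊ ≤ Real.exp (-(1 / M)) ^ ⌈7 * M⌉₊ := by gcongr
          _ = Real.exp (-(⌈7 * M⌉₊ / M)) := by rw [← Real.exp_nat_mul]; congr 1; ring
          _ ≤ Real.exp (-7) := by
            gcongr
            rw [le_div_iff₀ hM0]
            exact Nat.le_ceil _
          _ < 1 / 1024 := by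
            rw [Real.exp_neg, ← one_div]
            apply one_div_lt_one_div_of_lt (by norm_num)
            have h2 : Real.exp 7 = Real.exp 1 ^ 7 := by rw [← Real.exp_nat_mul]; norm_num
            rw [h2]
            calc (1024 : ℝ) < 2.71 ^ 7 := by norm_num
              _ ≤ Real.exp 1 ^ 7 := by
                gcongr
                linarith [Real.exp_one_gt_d9]
      have e1 : 1 / (512 * √L) / (1 - z) = n / 512 := by
        rw [h1z, hM]
        field_simp
      have e2 : 1 / (n : ℝ) * (n / 16) ^ 2 = n / 256 := by
        field_simp
        norm_num
      rw [e1, e2, div_div_eq_mul_div, div_one]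
      nlinarith)
  refine ⟨t, ?_, ?_⟩
  · rw [hroot]
    have h1 : (t : ℝ) ≤ ⌈7 * M⌉₊ := by exact_mod_cast ht.le
    have := Nat.ceil_lt_add_one (show 0 ≤ 7 * M by positivity)
    linarith
  · refine le_trans ?_ (norm_inner_sq_le_successProb 0 t)
    rw [walkIsometry_iterate] at hδ
    refine le_trans (le_of_eq ?_) (pow_le_pow_left₀ (by positivity) hδ 2)
    rw [div_pow, mul_pow, hsq]
    field_simp
    norm_num

end GridWalk

end

theorem theorem1 :
    ∃ (T : ℕ → ℕ) (K c : ℝ), 0 < K ∧ 0 < c ∧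
      ∀ (n : ℕ) [NeZero n], 2 ≤ n →
        (T n : ℝ) ≤ K * √((n : ℝ) ^ 2 * Real.log ((n : ℝ) ^ 2)) ∧
        ∀ v : GridWalk.Vertex n,
          c / Real.log ((n : ℝ) ^ 2) ≤ GridWalk.successProb n v (T n) := by
  -- `T` is chosen before the instance and the bound on `n`, so that `choose` yields a function on
  -- all of ℕ.
  have h : ∀ n : ℕ, ∃ T : ℕ, ∀ [NeZero n], 2 ≤ n →
      (T : ℝ) ≤ 8 * √((n : ℝ) ^ 2 * Real.log ((n : ℝ) ^ 2)) ∧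
      1 / 2 ^ 18 / Real.log ((n : ℝ) ^ 2) ≤ GridWalk.successProb n 0 T := by
    intro n
    by_cases hn : 2 ≤ n
    · have : NeZero n := ⟨by omega⟩
      obtain ⟨T, hT⟩ := GridWalk.exists_le_successProb hn
      exact ⟨T, fun _ => hT⟩
    · exact ⟨0, fun h => absurd h hn⟩
  choose T hT using h
  refine ⟨T, 8, 1 / 2 ^ 18, by norm_num, by norm_num, fun n _ hn => ⟨(hT n hn).1, fun v => ?_⟩⟩
  rw [GridWalk.successProb_eq v]
  exact (hT n hn).2
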